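/- Let $d\ge 1$ be an integer, $p\ge 1$ a real number and $|\cdot|$ a norm on $\mathbb{R}^d$. Let $\mu$ and $\nu$ be Borel probability measures on $[0,1]^d$ (also viewed as measures on $\mathbb{R}^d$). Put $$\mathcal{W}_p(\mu,\nu)=\inf\Big\{\big(\mathbb{E}\,|X-Y|^p\big)^{1/p} : X\sim\mu,\ Y\sim\nu\Big\},\qquad \mathfrak{d}_d=\sup_{x,y\in(0,1]^d}|y-x|,$$ $$D^\infty=D^\infty(\mu,\nu)=\sup_{x,y\in[0,1]^d}\big|\mu([\![x,y]\!])-\nu([\![x,y]\!])\big|,$$ where $[\![x,y]\!]=\prod_{i=1}^d[x^i,y^i]$ if $x^i\le y^i$ for all $i$, and $[\![x,y]\!]=\varnothing$ otherwise. Then $\mathcal{W}_p(\mu,\nu)<\infty$ and, with the convention $0\log(1/0)=0$: 1. If $p>d$, then $$\mathcal{W}_p^p(\mu,\nu)\le\frac{\mathfrak{d}_d^p(2^p+1)}{2(2^{p-d}-1)}\,D^\infty .$$ If furthermore $1+2^{-p}-2^{p-d}>0$, that is (equivalently) $p<d+\frac{\log(1+\sqrt{1+2^{-(d-2)}})}{\log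 2}-1$, then $$\mathcal{W}_p^p(\mu,\nu)\le\frac{\mathfrak{d}_d^p}{2^{p-d}-1}\left[\frac{2^p+1}{2}D^\infty-2^{p(1-\frac1d)}\big(1+2^{-p}-2^{p-d}\big)(D^\infty)^{\frac pd}\right].$$ 2. If $p=d$, then $$\mathcal{W}_p^p(\mu,\nu)\le\mathfrak{d}_d^d\left(\Big(\frac{(d+1)2^{d-1}}{d}+\frac1{2d}\Big)D^\infty+\frac{2^d+1}{2d\log 2}\,D^\infty\log\Big(\frac1{D^\infty}\Big)\right).$$ 3. If $p<d$, then $$\mathcal{W}_p^p(\mu,\nu)\le\mathfrak{d}_d^p\,2^{-\frac pd}\left(\frac{2^p+1}{1-2^{p-d}}+2^p\right)(D^\infty)^{\frac pd}.$$ -/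

import Mathlib

open MeasureTheory
open scoped ENNReal

noncomputable section

/-- The closed unit cube `[0,1]^d`. -/
def unitCube (d : ℕ) : Set (Fin d → ℝ) :=
  Set.Icc 0 1

/-- The half-open unit cube `(0,1]^d`. -/
def halfOpenCube (d : ℕ) : Set (Fin d → ℝ) :=
  {x | ∀ i, 0 < x i ∧ x i ≤ 1}

/-- The couplings of `μ` and `ν`: measures on the product with marginals `μ` and `ν`,
i.e. the joint laws of pairs `(X, Y)` with `X` of law `μ` and `Y` of law `ν`. -/
def couplings {d : ℕ} (μ ν : Measure (Fin d → ℝ)) :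
    Set (Measure ((Fin d → ℝ) × (Fin d → ℝ))) :=
  {π | π.map Prod.fst = μ ∧ π.map Prod.snd = ν}

/-- The `p`-Wasserstein distance with respect to the norm `N` on `ℝ^d`:
the infimum of `(E N(X - Y)^p)^(1/p)` over all couplings `(X, Y)` of `μ` and `ν`,
as an extended nonnegative real number. -/
def wassersteinDistance {d : ℕ} (N : Seminorm ℝ (Fin d → ℝ)) (p : ℝ)
    (μ ν : Measure (Fin d → ℝ)) : ℝ≥0∞ :=
  ⨅ π ∈ couplings μ ν, (∫⁻ z, ENNReal.ofReal (N (z.1 - z.2) ^ p) ∂π) ^ (1 / p)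

/-- The uniform discrepancy: the supremum over `x, y ∈ [0,1]^d` of `|μ([x,y]) - ν([x,y])|`,
where the closed box `[x,y]` is `Set.Icc x y` (empty unless `x i ≤ y i` for every `i`). -/
def uniformDiscrepancy {d : ℕ} (μ ν : Measure (Fin d → ℝ)) : ℝ :=
  sSup {r | ∃ x ∈ unitCube d, ∃ y ∈ unitCube d,
    r = |μ.real (Set.Icc x y) - ν.real (Set.Icc x y)|}

/-- The diameter of the half-open unit cube `(0,1]^d` for the norm `N`. -/
def cubeDiameter {d : ℕ} (N : Seminorm ℝ (Fin d → ℝ)) : ℝ :=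
  sSup {r | ∃ x ∈ halfOpenCube d, ∃ y ∈ halfOpenCube d, r = N (y - x)}

end

/-!
Both measures are coupled along the dyadic partitions of the cube, from fine to coarse. At level `L`
as much mass as possible, namely `∑ min (μ(C)) (ν(C))` over the cells `C`, is coupled inside the
cells. Passing from level `n + 1` to level `n`, what is left over in each cell of level `n` is again
coupled inside that cell as far as the masses allow
(`exists_partial_coupling_extension`); a multiple of the product of the leftovers does this. The
resulting total coupled mass at level `n` is `∑ min (μ(C)) (ν(C))`, so the mass added at level `n`
is at most `1 - ∑ min (μ(C')) (ν(C'))`, the sum being over the cells `C'` of level `n + 1`; that is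
half the sum of the `|μ(C') - ν(C')|`, hence at most `2^(d(n+1)) D / 2`, where `D` is the uniform
discrepancy. It is moved by at most `2⁻ⁿ` times the diameter `E` of the cube. At level `0` there is
one cell and everything is coupled. This gives, for every `L`
(`wassersteinDistance_rpow_le`),
`W ^ p ≤ E ^ p * (2^(-pL) + 2^p / 2 * D * ∑_{1 ≤ n ≤ L} 2^((d-p)n))`.

A half-open dyadic cell is not a closed box, but it is an increasing union of closed boxes within
the unit cube, so its discrepancy is at most `D` as well
(`abs_measureReal_dyadicCell_sub_le`).

The three regimes come from summing the geometric series and taking either `L → ∞` or the level at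
which the volume `2^(-dL)` of a cell lies between `D / 2` and `2^d D / 2`
(`exists_level_estimates`). Since the mass added at level `n` is controlled by the cells of level
`n + 1` alone, the factor in front of the sum is `2^p / 2`, which leaves some room below the
stated `(2^p + 1) / 2`.
-/

/-! ### Coupling along a sequence of nested partitions -/

/-- The largest partial coupling of two finite measures: its marginals lie below the given measures
and its mass is the smaller of the two masses. It is a multiple of the product measure. -/
theorem exists_maximal_partial_coupling {X : Type*} [MeasurableSpace X]
    (α β : Measure X) [IsFiniteMeasure α] [IsFiniteMeasure β] :
    ∃ ρ : Measure (X × X), ρ.map Prod.fst ≤ α ∧ ρ.map Prod.snd ≤ β ∧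
      ρ Set.univ = min (α Set.univ) (β Set.univ) ∧ ρ ≪ α.prod β := by
  set m := max (α Set.univ) (β Set.univ) with hm
  have hmtop : m ≠ ∞ := by simp [hm]
  have hle : ∀ x : ℝ≥0∞, x ≤ m → m⁻¹ * x ≤ 1 := fun x hx =>
    (mul_le_mul_right hx _).trans (ENNReal.inv_mul_le_one m)
  refine ⟨m⁻¹ • α.prod β, ?_, ?_, ?_, Measure.smul_absolutelyContinuous⟩
  · rw [Measure.map_smul, Measure.map_fst_prod, smul_smul]
    exact fun s => by
      simpa using mul_le_mul_left (hle _ (le_max_right _ _)) (α s)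
  · rw [Measure.map_smul, Measure.map_snd_prod, smul_smul]
    exact fun s => by
      simpa using mul_le_mul_left (hle _ (le_max_left _ _)) (β s)
  · rw [Measure.smul_apply, smul_eq_mul, ← Set.univ_prod_univ, Measure.prod_prod]
    rcases eq_or_ne m 0 with h0 | h0
    · have h1 : α Set.univ = 0 := le_antisymm (h0 ▸ le_max_left _ _) zero_le
      simp [h1]
    · rw [← min_mul_max (α Set.univ), ← hm, mul_comm, mul_assoc, ENNReal.mul_inv_cancel h0 hmtop,
        mul_one]

/-- A partial coupling that respects the cells of `q` extends, within the cells, to one whose mass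
on each cell is the smaller of the two masses of the cell. -/
theorem exists_partial_coupling_extension {X K : Type*} [MeasurableSpace X] [Fintype K]
    [MeasurableSpace K] [MeasurableSingletonClass K]
    (μ ν : Measure X) [IsFiniteMeasure μ] [IsFiniteMeasure ν] {q : X → K} (hq : Measurable q)
    (π : Measure (X × X)) (h1 : π.map Prod.fst ≤ μ) (h2 : π.map Prod.snd ≤ ν)
    (hc : ∀ᵐ z ∂π, q z.1 = q z.2) :
    ∃ ρ : Measure (X × X), (π + ρ).map Prod.fst ≤ μ ∧ (π + ρ).map Prod.snd ≤ ν ∧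
      (∀ᵐ z ∂ρ, q z.1 = q z.2) ∧
      (π + ρ) Set.univ = ∑ k, min (μ (q ⁻¹' {k})) (ν (q ⁻¹' {k})) := by
  classical
  have hA : ∀ k, MeasurableSet (q ⁻¹' {k}) := fun k => hq (measurableSet_singleton k)
  have hdisj : Pairwise (Function.onFun Disjoint fun k => q ⁻¹' {k}) := fun i j hij =>
    Set.disjoint_left.2 fun x hx hx' => hij (hx.symm.trans hx')
  have hcover : (⋃ k, q ⁻¹' {k}) = Set.univ := by
    ext x; simp
  have : IsFiniteMeasure (π.map Prod.fst) := isFiniteMeasure_of_le μ h1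
  have : IsFiniteMeasure (π.map Prod.snd) := isFiniteMeasure_of_le ν h2
  set α := μ - π.map Prod.fst with hα
  set β := ν - π.map Prod.snd with hβ
  have hαμ : α + π.map Prod.fst = μ := Measure.sub_add_cancel_of_le h1
  have hβν : β + π.map Prod.snd = ν := Measure.sub_add_cancel_of_le h2
  choose ρ hρ1 hρ2 hρm hρac using fun k =>
    exists_maximal_partial_coupling (α.restrict (q ⁻¹' {k})) (β.restrict (q ⁻¹' {k}))
  have hdecomp : ∀ γ : Measure X, ∑ k, γ.restrict (q ⁻¹' {k}) = γ := fun γ => by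
    rw [← Measure.sum_fintype, ← Measure.restrict_iUnion hdisj hA, hcover, Measure.restrict_univ]
  have hmapsum : ∀ f : X × X → X, Measurable f → (∑ k, ρ k).map f = ∑ k, (ρ k).map f := by
    intro f hf
    rw [← Measure.mapₗ_apply_of_measurable hf, map_sum]
    exact Finset.sum_congr rfl fun k _ => Measure.mapₗ_apply_of_measurable hf _
  refine ⟨∑ k, ρ k, ?_, ?_, ?_, ?_⟩
  · rw [Measure.map_add _ _ measurable_fst, hmapsum _ measurable_fst, add_comm]
    conv_rhs => rw [← hαμ]
    gcongr
    conv_rhs => rw [← hdecomp α]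
    exact Finset.sum_le_sum fun k _ => hρ1 k
  · rw [Measure.map_add _ _ measurable_snd, hmapsum _ measurable_snd, add_comm]
    conv_rhs => rw [← hβν]
    gcongr
    conv_rhs => rw [← hdecomp β]
    exact Finset.sum_le_sum fun k _ => hρ2 k
  · rw [← Measure.sum_fintype, Measure.ae_sum_iff]
    intro k
    refine (hρac k).ae_le ?_
    rw [Measure.prod_restrict]
    filter_upwards [ae_restrict_mem ((hA k).prod (hA k))] with z hz
    exact hz.1.trans hz.2.symm
  · have hπ : π Set.univ = ∑ k, π.map Prod.fst (q ⁻¹' {k}) := by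
      rw [← tsum_fintype (L := .unconditional _), ← measure_iUnion hdisj hA, hcover,
        Measure.map_apply measurable_fst .univ, Set.preimage_univ]
    -- On a cell, both marginals of `π` have the same mass, as `π` couples each cell with itself.
    have hsame : ∀ k, π.map Prod.fst (q ⁻¹' {k}) = π.map Prod.snd (q ⁻¹' {k}) := fun k => by
      rw [Measure.map_apply measurable_fst (hA k), Measure.map_apply measurable_snd (hA k)]
      refine measure_congr ?_
      filter_upwards [hc] with z hz
      exact congrArg (· = k) hz
    rw [Measure.add_apply, hπ, Measure.finsetSum_apply, ← Finset.sum_add_distrib]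
    refine Finset.sum_congr rfl fun k _ => ?_
    rw [hρm, Measure.restrict_apply_univ, Measure.restrict_apply_univ, ← min_add_add_left]
    conv_rhs => rw [← hαμ, ← hβν]
    rw [Measure.add_apply, Measure.add_apply, add_comm, ← hsame k, add_comm (β _)]

/-- The mass `∑ₖ min (μ(Aₖ)) (ν(Aₖ))` that two measures have in common when only the cells
`Aₖ = q⁻¹(k)` of a partition are seen. -/
noncomputable def commonMass {X K : Type*} [MeasurableSpace X] [Fintype K]
    (μ ν : Measure X) (q : X → K) : ℝ≥0∞ :=
  ∑ k, min (μ (q ⁻¹' {k})) (ν (q ⁻¹' {k}))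

theorem commonMass_le_measure_univ {X K : Type*} [MeasurableSpace X] [Fintype K]
    [MeasurableSpace K] [MeasurableSingletonClass K] (μ ν : Measure X) {q : X → K}
    (hq : Measurable q) : commonMass μ ν q ≤ μ Set.univ := by
  calc commonMass μ ν q ≤ ∑ k, μ (q ⁻¹' {k}) := Finset.sum_le_sum fun _ _ => min_le_left _ _
    _ = μ Set.univ := by
      rw [sum_measure_preimage_singleton _ fun k _ => hq (measurableSet_singleton k)]; simp

/-- A cost bounded by `e n` on pairs in the same level-`n` cell admits a partial coupling, built
from level `n + m` up to level `n`, of the full common mass at level `n`. The mass added at level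
`n + i` is at most what the common mass at level `n + i + 1` lacks. -/
theorem exists_multiscale_partial_coupling {X : Type*} [MeasurableSpace X] {K : ℕ → Type*}
    [∀ n, Fintype (K n)] [∀ n, MeasurableSpace (K n)] [∀ n, MeasurableSingletonClass (K n)]
    (μ ν : Measure X) [IsProbabilityMeasure μ] [IsProbabilityMeasure ν]
    {q : ∀ n, X → K n} (hq : ∀ n, Measurable (q n))
    (hnest : ∀ n x y, q (n + 1) x = q (n + 1) y → q n x = q n y)
    {S : Set X} (hμS : ∀ᵐ x ∂μ, x ∈ S) (hνS : ∀ᵐ x ∂ν, x ∈ S)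
    {c : X × X → ℝ≥0∞} {e : ℕ → ℝ≥0∞}
    (hce : ∀ n, ∀ x ∈ S, ∀ y ∈ S, q n x = q n y → c (x, y) ≤ e n) (m n : ℕ) :
    ∃ π : Measure (X × X), π.map Prod.fst ≤ μ ∧ π.map Prod.snd ≤ ν ∧
      (∀ᵐ z ∂π, q n z.1 = q n z.2) ∧ π Set.univ = commonMass μ ν (q n) ∧
      ∫⁻ z, c z ∂π ≤
        e (n + m) + ∑ i ∈ Finset.range m, e (n + i) * (1 - commonMass μ ν (q (n + i + 1))) := by
  have hM : ∀ n, commonMass μ ν (q n) ≤ 1 := fun n => by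
    simpa using commonMass_le_measure_univ μ ν (hq n)
  have hcost : ∀ n (ρ : Measure (X × X)), ρ.map Prod.fst ≤ μ → ρ.map Prod.snd ≤ ν →
      (∀ᵐ z ∂ρ, q n z.1 = q n z.2) → ∫⁻ z, c z ∂ρ ≤ e n * ρ Set.univ := by
    intro n ρ h1 h2 h3
    rw [← lintegral_const]
    refine lintegral_mono_ae ?_
    have h1' := ae_of_ae_map measurable_fst.aemeasurable (ae_mono h1 hμS)
    have h2' := ae_of_ae_map measurable_snd.aemeasurable (ae_mono h2 hνS)
    filter_upwards [h1', h2', h3] with z hz1 hz2 hz3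
    exact hce n _ hz1 _ hz2 hz3
  induction m generalizing n with
  | zero =>
    obtain ⟨ρ, h1, h2, h3, h4⟩ := exists_partial_coupling_extension μ ν (hq n) 0
      (by simp [Measure.zero_le]) (by simp [Measure.zero_le]) (by simp)
    rw [zero_add] at h1 h2 h4
    refine ⟨ρ, h1, h2, h3, h4, ?_⟩
    simpa using (hcost n ρ h1 h2 h3).trans (mul_le_of_le_one_right' (h4.trans_le (hM n)))
  | succ m ih =>
    obtain ⟨π, h1, h2, h3, h4, h5⟩ := ih (n + 1)
    have h3' : ∀ᵐ z ∂π, q n z.1 = q n z.2 := h3.mono fun z hz => hnest n _ _ hz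
    obtain ⟨ρ, g1, g2, g3, g4⟩ := exists_partial_coupling_extension μ ν (hq n) π h1 h2 h3'
    have hρle : ρ ≤ π + ρ := Measure.le_add_left le_rfl
    refine ⟨π + ρ, g1, g2, ae_add_measure_iff.2 ⟨h3', g3⟩, g4, ?_⟩
    have hρ : ρ Set.univ ≤ 1 - commonMass μ ν (q (n + 1)) := by
      refine ENNReal.le_sub_of_add_le_left ((hM _).trans_lt ENNReal.one_lt_top).ne ?_
      rw [← h4, ← Measure.add_apply, g4]
      exact hM n
    have hρc := hcost n ρ ((Measure.map_mono hρle measurable_fst).trans g1)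
      ((Measure.map_mono hρle measurable_snd).trans g2) g3
    rw [lintegral_add_measure, Finset.sum_range_succ', ← add_assoc]
    refine add_le_add (h5.trans (le_of_eq ?_)) (hρc.trans (by simpa using mul_le_mul_right hρ _))
    have hidx : ∀ a b, a = b → commonMass μ ν (q a) = commonMass μ ν (q b) := by
      rintro a _ rfl; rfl
    congr 1
    · congr 1; ring
    · refine Finset.sum_congr rfl fun i _ => ?_
      rw [hidx (n + 1 + i + 1) (n + (i + 1) + 1) (by ring), add_right_comm n 1 i, add_assoc n i 1]

/-- If the coarsest partition has only one cell, the multiscale construction yields a genuine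
coupling. -/
theorem exists_multiscale_coupling {X : Type*} [MeasurableSpace X] {K : ℕ → Type*}
    [∀ n, Fintype (K n)] [∀ n, MeasurableSpace (K n)] [∀ n, MeasurableSingletonClass (K n)]
    [Subsingleton (K 0)]
    (μ ν : Measure X) [IsProbabilityMeasure μ] [IsProbabilityMeasure ν]
    {q : ∀ n, X → K n} (hq : ∀ n, Measurable (q n))
    (hnest : ∀ n x y, q (n + 1) x = q (n + 1) y → q n x = q n y)
    {S : Set X} (hμS : ∀ᵐ x ∂μ, x ∈ S) (hνS : ∀ᵐ x ∂ν, x ∈ S)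
    {c : X × X → ℝ≥0∞} {e : ℕ → ℝ≥0∞}
    (hce : ∀ n, ∀ x ∈ S, ∀ y ∈ S, q n x = q n y → c (x, y) ≤ e n) (m : ℕ) :
    ∃ π : Measure (X × X), π.map Prod.fst = μ ∧ π.map Prod.snd = ν ∧
      ∫⁻ z, c z ∂π ≤
        e m + ∑ i ∈ Finset.range m, e i * (1 - commonMass μ ν (q (i + 1))) := by
  obtain ⟨π, h1, h2, -, h4, h5⟩ :=
    exists_multiscale_partial_coupling μ ν hq hnest hμS hνS hce m 0
  have hX : Nonempty X := by
    by_contra h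
    rw [not_nonempty_iff] at h
    simpa [Measure.eq_zero_of_isEmpty] using measure_univ (μ := μ)
  obtain ⟨x⟩ := hX
  have hone : π Set.univ = 1 := by
    have hpre : ∀ k, q 0 ⁻¹' {k} = Set.univ := fun k =>
      Set.eq_univ_of_forall fun y => Subsingleton.elim _ _
    rw [h4, commonMass, Fintype.sum_subsingleton _ (q 0 x)]
    simp [hpre]
  have hfst : IsFiniteMeasure (π.map Prod.fst) := isFiniteMeasure_of_le μ h1
  have hsnd : IsFiniteMeasure (π.map Prod.snd) := isFiniteMeasure_of_le ν h2
  refine ⟨π, ?_, ?_, ?_⟩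
  · refine Measure.eq_of_le_of_measure_univ_eq h1 ?_
    rw [Measure.map_apply measurable_fst .univ, Set.preimage_univ, hone, measure_univ]
  · refine Measure.eq_of_le_of_measure_univ_eq h2 ?_
    rw [Measure.map_apply measurable_snd .univ, Set.preimage_univ, hone, measure_univ]
  · have hidx : ∀ a b, a = b → commonMass μ ν (q a) = commonMass μ ν (q b) := by
      rintro a _ rfl; rfl
    simpa only [zero_add, fun i => hidx (0 + i + 1) (i + 1) (by ring)] using h5

/-- The mass not shared by two probability measures is half the sum of the discrepancies of the
cells. -/
theorem one_sub_commonMass_le {X K : Type*} [MeasurableSpace X] [Fintype K]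
    [MeasurableSpace K] [MeasurableSingletonClass K]
    (μ ν : Measure X) [IsProbabilityMeasure μ] [IsProbabilityMeasure ν]
    {q : X → K} (hq : Measurable q) {D : ℝ} (hD0 : 0 ≤ D)
    (hD : ∀ k, |μ.real (q ⁻¹' {k}) - ν.real (q ⁻¹' {k})| ≤ D) :
    1 - commonMass μ ν q ≤ ENNReal.ofReal (Fintype.card K * D / 2) := by
  have hsum : ∀ (γ : Measure X) [IsProbabilityMeasure γ], ∑ k, γ.real (q ⁻¹' {k}) = 1 := by
    intro γ _
    rw [sum_measureReal_preimage_singleton _ fun k _ => hq (measurableSet_singleton k)]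
    simp
  have hM : commonMass μ ν q =
      ENNReal.ofReal (∑ k, min (μ.real (q ⁻¹' {k})) (ν.real (q ⁻¹' {k}))) := by
    rw [commonMass, ENNReal.ofReal_sum_of_nonneg fun k _ =>
      le_min measureReal_nonneg measureReal_nonneg]
    refine Finset.sum_congr rfl fun k _ => ?_
    rw [ENNReal.ofReal_min, ofReal_measureReal, ofReal_measureReal]
  rw [tsub_le_iff_right, hM, ← ENNReal.ofReal_add (by positivity)
    (Finset.sum_nonneg fun k _ => le_min measureReal_nonneg measureReal_nonneg),
    ← ENNReal.ofReal_one]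
  refine ENNReal.ofReal_le_ofReal ?_
  have hmin : ∀ k, (μ.real (q ⁻¹' {k}) + ν.real (q ⁻¹' {k}) - D) / 2 ≤
      min (μ.real (q ⁻¹' {k})) (ν.real (q ⁻¹' {k})) := fun k => by
    have := abs_le.1 (hD k)
    refine le_min ?_ ?_ <;> linarith
  have := Finset.sum_le_sum fun k (_ : k ∈ Finset.univ) => hmin k
  rw [← Finset.sum_div, Finset.sum_sub_distrib, Finset.sum_add_distrib, hsum μ, hsum ν] at this
  simp only [Finset.sum_const, Finset.card_univ, nsmul_eq_mul] at this
  linarith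

/-! ### Dyadic cells of the cube -/

/-- The index of the dyadic cell of side `2⁻ⁿ` of `x`: in each coordinate, the `k`-th interval is
`(k/2ⁿ, (k+1)/2ⁿ]`, where the interval `k = 0` extends to `-∞` (so that it contains `0`) and the
interval `k = 2ⁿ - 1` extends to `∞`. -/
noncomputable def dyadicCell (d n : ℕ) (x : Fin d → ℝ) : Fin d → Fin (2 ^ n) := fun i =>
  ⟨min (⌈2 ^ n * x i⌉₊ - 1) (2 ^ n - 1), by have := Nat.one_le_two_pow (n := n); omega⟩

theorem measurable_dyadicCell (d n : ℕ) : Measurable (dyadicCell d n) := by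
  refine measurable_pi_iff.2 fun i => ?_
  have hf : Measurable fun k : ℕ => (⟨min (k - 1) (2 ^ n - 1), by
      have := Nat.one_le_two_pow (n := n); omega⟩ : Fin (2 ^ n)) := measurable_of_countable _
  exact hf.comp (Nat.measurable_ceil.comp ((measurable_pi_apply i).const_mul _))

theorem dyadicCell_nested (d n : ℕ) (x y : Fin d → ℝ)
    (h : dyadicCell d (n + 1) x = dyadicCell d (n + 1) y) :
    dyadicCell d n x = dyadicCell d n y := by
  have hceil : ∀ t : ℝ, ⌈2 ^ n * t⌉₊ = (⌈2 ^ (n + 1) * t⌉₊ + 1) / 2 := fun t => by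
    refine eq_of_forall_ge_iff fun m => ?_
    have h2 : (⌈2 ^ (n + 1) * t⌉₊ + 1) / 2 ≤ m ↔ ⌈2 ^ (n + 1) * t⌉₊ ≤ 2 * m := by omega
    rw [h2, Nat.ceil_le, Nat.ceil_le, pow_succ]
    push_cast
    constructor <;> intro h <;> linarith
  funext i
  have hi := congrArg Fin.val (congrFun h i)
  simp only [dyadicCell] at hi
  refine Fin.ext ?_
  simp only [dyadicCell, hceil]
  have := Nat.one_le_two_pow (n := n)
  have h2 : 2 ^ (n + 1) = 2 * 2 ^ n := pow_succ' 2 n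
  omega

theorem dyadicCell_apply_eq_iff {d n : ℕ} {x : Fin d → ℝ} (hx : x ∈ unitCube d) (i : Fin d)
    (k : Fin (2 ^ n)) :
    dyadicCell d n x i = k ↔
      ((k : ℕ) = 0 ∨ (k : ℝ) < 2 ^ n * x i) ∧ 2 ^ n * x i ≤ (k : ℝ) + 1 := by
  have hle : ⌈2 ^ n * x i⌉₊ ≤ 2 ^ n := by
    rw [Nat.ceil_le]
    push_cast
    exact mul_le_of_le_one_right (by positivity) (hx.2 i)
  have h1 : (k : ℝ) < 2 ^ n * x i ↔ (k : ℕ) < ⌈2 ^ n * x i⌉₊ := Nat.lt_ceil.symm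
  have h2 : 2 ^ n * x i ≤ (k : ℝ) + 1 ↔ ⌈2 ^ n * x i⌉₊ ≤ (k : ℕ) + 1 := by
    rw [Nat.ceil_le]; push_cast; rfl
  have hk := k.2
  rw [h1, h2, Fin.ext_iff]
  simp only [dyadicCell]
  omega

theorem abs_sub_le_of_dyadicCell_eq {d n : ℕ} {x y : Fin d → ℝ} (hx : x ∈ unitCube d)
    (hy : y ∈ unitCube d) (h : dyadicCell d n x = dyadicCell d n y) (i : Fin d) :
    |2 ^ n * (x i - y i)| ≤ 1 := by
  obtain ⟨h1, h2⟩ := (dyadicCell_apply_eq_iff hx i _).1 rfl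
  obtain ⟨h3, h4⟩ := (dyadicCell_apply_eq_iff hy i _).1 rfl
  rw [← h] at h3 h4
  have key : ∀ z ∈ unitCube d, (((dyadicCell d n x i : Fin (2 ^ n)) : ℕ) = 0 ∨
      ((dyadicCell d n x i : Fin (2 ^ n)) : ℝ) < 2 ^ n * z i) →
      ((dyadicCell d n x i : Fin (2 ^ n)) : ℝ) ≤ 2 ^ n * z i := by
    rintro z hz (h0 | h0)
    · rw [h0, Nat.cast_zero]
      exact mul_nonneg (by positivity) (hz.1 i)
    · exact h0.le
  have h1' := key x hx h1
  have h3' := key y hy h3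
  rw [mul_sub, abs_le]
  constructor <;> linarith

/-! ### The discrepancy of dyadic cells -/

theorem abs_measureReal_sub_le_one {X : Type*} [MeasurableSpace X] (μ ν : Measure X)
    [IsProbabilityMeasure μ] [IsProbabilityMeasure ν] (s : Set X) :
    |μ.real s - ν.real s| ≤ 1 :=
  abs_sub_le_iff.2 ⟨(sub_le_self _ measureReal_nonneg).trans measureReal_le_one,
    (sub_le_self _ measureReal_nonneg).trans measureReal_le_one⟩

theorem bddAbove_discrepancy {d : ℕ} (μ ν : Measure (Fin d → ℝ)) [IsProbabilityMeasure μ]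
    [IsProbabilityMeasure ν] :
    BddAbove {r | ∃ x ∈ unitCube d, ∃ y ∈ unitCube d,
      r = |μ.real (Set.Icc x y) - ν.real (Set.Icc x y)|} := by
  refine ⟨1, ?_⟩
  rintro r ⟨x, -, y, -, rfl⟩
  exact abs_measureReal_sub_le_one μ ν _

theorem uniformDiscrepancy_nonneg {d : ℕ} (μ ν : Measure (Fin d → ℝ)) :
    0 ≤ uniformDiscrepancy μ ν := by
  refine Real.sSup_nonneg ?_
  rintro r ⟨x, -, y, -, rfl⟩
  exact abs_nonneg _

theorem uniformDiscrepancy_le_one {d : ℕ} (μ ν : Measure (Fin d → ℝ)) [IsProbabilityMeasure μ]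
    [IsProbabilityMeasure ν] : uniformDiscrepancy μ ν ≤ 1 := by
  refine Real.sSup_le ?_ zero_le_one
  rintro r ⟨x, -, y, -, rfl⟩
  exact abs_measureReal_sub_le_one μ ν _

/-- A half-open dyadic cell is an increasing union of closed boxes, so its discrepancy is a limit
of discrepancies of closed boxes. -/
theorem abs_measureReal_dyadicCell_sub_le {d n : ℕ} (μ ν : Measure (Fin d → ℝ))
    [IsProbabilityMeasure μ] [IsProbabilityMeasure ν]
    (hμ : ∀ᵐ x ∂μ, x ∈ unitCube d) (hν : ∀ᵐ x ∂ν, x ∈ unitCube d) (k : Fin d → Fin (2 ^ n)) :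
    |μ.real (dyadicCell d n ⁻¹' {k}) - ν.real (dyadicCell d n ⁻¹' {k})| ≤
      uniformDiscrepancy μ ν := by
  have h2n : (0 : ℝ) < 2 ^ n := by positivity
  set b : Fin d → ℝ := fun i => ((k i : ℕ) + 1) / 2 ^ n with hb
  set a : ℕ → Fin d → ℝ := fun m i =>
    if (k i : ℕ) = 0 then 0 else ((k i : ℕ) + 1 / ((m : ℝ) + 1)) / 2 ^ n with ha
  have hkle : ∀ i, ((k i : ℕ) : ℝ) + 1 ≤ 2 ^ n := fun i => by
    have := (k i).2
    exact_mod_cast this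
  have hinv : ∀ m : ℕ, 0 < 1 / ((m : ℝ) + 1) ∧ 1 / ((m : ℝ) + 1) ≤ 1 := fun m =>
    ⟨by positivity, by
      rw [div_le_one (by positivity)]
      linarith [(Nat.cast_nonneg m : (0 : ℝ) ≤ m)]⟩
  have hbmem : b ∈ unitCube d := ⟨fun i => by simp only [hb, Pi.zero_apply]; positivity,
    fun i => by simpa only [hb, Pi.one_apply, div_le_one h2n] using hkle i⟩
  have hamem : ∀ m, a m ∈ unitCube d := fun m => by
    refine ⟨fun i => ?_, fun i => ?_⟩
    · simp only [ha, Pi.zero_apply]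
      split_ifs
      · exact le_rfl
      · positivity
    · simp only [ha, Pi.one_apply]
      split_ifs
      · exact zero_le_one
      · rw [div_le_one h2n]
        linarith [hkle i, (hinv m).2]
  have hmono : Monotone fun m => Set.Icc (a m) b := by
    intro m m' hmm
    refine Set.Icc_subset_Icc_left fun i => ?_
    simp only [ha]
    split_ifs
    · exact le_rfl
    · gcongr
  have hunion : (⋃ m, Set.Icc (a m) b) = dyadicCell d n ⁻¹' {k} ∩ unitCube d := by
    ext x
    rw [Set.mem_iUnion]
    constructor
    · rintro ⟨m, hx1, hx2⟩
      have hx : x ∈ unitCube d := ⟨(hamem m).1.trans hx1, hx2.trans hbmem.2⟩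
      refine ⟨funext fun i => (dyadicCell_apply_eq_iff hx i _).2 ⟨?_, ?_⟩, hx⟩
      · refine or_iff_not_imp_left.2 fun h0 => ?_
        have := hx1 i
        simp only [ha, if_neg h0, div_le_iff₀ h2n] at this
        linarith [(hinv m).1]
      · have := hx2 i
        simp only [hb, le_div_iff₀ h2n] at this
        linarith
    · rintro ⟨hxk, hx⟩
      have hiff := fun i => (dyadicCell_apply_eq_iff hx i (k i)).1 (congrFun hxk i)
      have hev : ∀ᶠ m : ℕ in Filter.atTop, ∀ i, a m i ≤ x i := by
        refine Filter.eventually_all.2 fun i => ?_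
        by_cases h0 : (k i : ℕ) = 0
        · exact Filter.Eventually.of_forall fun m => by
            simp only [ha, if_pos h0]
            exact hx.1 i
        · have hlt := (hiff i).1.resolve_left h0
          filter_upwards [tendsto_one_div_add_atTop_nhds_zero_nat.eventually_le_const
            (sub_pos.2 hlt)] with m hm
          simp only [ha, if_neg h0, div_le_iff₀ h2n]
          linarith
      obtain ⟨m, hm⟩ := hev.exists
      refine ⟨m, hm, fun i => ?_⟩
      simp only [hb, le_div_iff₀ h2n]
      linarith [(hiff i).2]
  have hlim : ∀ (γ : Measure (Fin d → ℝ)) [IsProbabilityMeasure γ], (∀ᵐ x ∂γ, x ∈ unitCube d) →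
      Filter.Tendsto (fun m => γ.real (Set.Icc (a m) b)) Filter.atTop
        (nhds (γ.real (dyadicCell d n ⁻¹' {k}))) := by
    intro γ _ hγ
    have heq : γ (dyadicCell d n ⁻¹' {k}) = γ (⋃ m, Set.Icc (a m) b) := by
      rw [hunion]
      refine measure_congr ?_
      filter_upwards [hγ] with x hx
      exact propext ⟨fun h => ⟨h, hx⟩, fun h => h.1⟩
    rw [measureReal_def, heq]
    exact (ENNReal.tendsto_toReal (measure_ne_top _ _)).comp (tendsto_measure_iUnion_atTop hmono)
  refine le_of_tendsto ((hlim μ hμ).sub (hlim ν hν)).abs (Filter.Eventually.of_forall fun m => ?_)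
  exact le_csSup (bddAbove_discrepancy μ ν) ⟨a m, hamem m, b, hbmem, rfl⟩

/-! ### The diameter of the cube -/

theorem seminorm_le_sum_of_abs_le_one {d : ℕ} (N : Seminorm ℝ (Fin d → ℝ)) {v : Fin d → ℝ}
    (hv : ∀ i, |v i| ≤ 1) : N v ≤ ∑ i, N (Pi.single i 1) := by
  have hdec : v = ∑ i, v i • (Pi.single i 1 : Fin d → ℝ) := by
    ext j; simp [Finset.sum_apply, Pi.single_apply]
  conv_lhs => rw [hdec]
  refine (Finset.le_sum_of_subadditive N (map_zero N).le (map_add_le_add N) _ _).trans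
    (Finset.sum_le_sum fun i _ => ?_)
  rw [map_smul_eq_mul, Real.norm_eq_abs]
  exact mul_le_of_le_one_left (apply_nonneg N _) (hv i)

/-- The diameter of the half-open cube bounds the seminorm on the whole of `[-1,1]^d`: for `c < 1`
the vector `c v` is a difference of points of the half-open cube. -/
theorem seminorm_le_cubeDiameter {d : ℕ} (N : Seminorm ℝ (Fin d → ℝ)) {v : Fin d → ℝ}
    (hv : ∀ i, |v i| ≤ 1) : N v ≤ cubeDiameter N := by
  have hbdd : BddAbove {r | ∃ x ∈ halfOpenCube d, ∃ y ∈ halfOpenCube d, r = N (y - x)} := by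
    refine ⟨∑ i, N (Pi.single i 1), ?_⟩
    rintro r ⟨x, hx, y, hy, rfl⟩
    refine seminorm_le_sum_of_abs_le_one N fun i => ?_
    have h1 := hx i
    have h2 := hy i
    rw [Pi.sub_apply, abs_le]
    constructor <;> linarith
  have hc : ∀ c : ℝ, 0 ≤ c → c < 1 → c * N v ≤ cubeDiameter N := by
    intro c hc0 hc1
    refine le_csSup hbdd ⟨fun i => (1 - c) + c * max (-v i) 0, fun i => ?_,
      fun i => (1 - c) + c * max (v i) 0, fun i => ?_, ?_⟩
    · have h1 : max (-v i) 0 ≤ 1 := max_le (neg_le.1 (abs_le.1 (hv i)).1) zero_le_one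
      have h2 : 0 ≤ max (-v i) 0 := le_max_right _ _
      constructor <;> nlinarith
    · have h1 : max (v i) 0 ≤ 1 := max_le (abs_le.1 (hv i)).2 zero_le_one
      have h2 : 0 ≤ max (v i) 0 := le_max_right _ _
      constructor <;> nlinarith
    · have hdiff : ((fun i => (1 - c) + c * max (v i) 0) - fun i => (1 - c) + c * max (-v i) 0) =
          c • v := by
        ext i
        have : max (v i) 0 - max (-v i) 0 = v i :=
          max_zero_sub_max_neg_zero_eq_self (v i)
        simp only [Pi.sub_apply, Pi.smul_apply, smul_eq_mul]
        linear_combination c * this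
      rw [hdiff, map_smul_eq_mul, Real.norm_of_nonneg hc0]
  have hlim : Filter.Tendsto (fun c : ℝ => c * N v) (nhdsWithin 1 (Set.Iio 1))
      (nhds (1 * N v)) :=
    ((continuous_id.mul continuous_const).tendsto 1).mono_left nhdsWithin_le_nhds
  rw [one_mul] at hlim
  refine le_of_tendsto hlim ?_
  filter_upwards [Ico_mem_nhdsLT (zero_lt_one' ℝ)] with c hc'
  exact hc c hc'.1 hc'.2

theorem cubeDiameter_nonneg {d : ℕ} (N : Seminorm ℝ (Fin d → ℝ)) : 0 ≤ cubeDiameter N := by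
  simpa using seminorm_le_cubeDiameter N (v := 0) (by simp)

theorem seminorm_sub_le_of_dyadicCell_eq {d n : ℕ} (N : Seminorm ℝ (Fin d → ℝ))
    {x y : Fin d → ℝ} (hx : x ∈ unitCube d) (hy : y ∈ unitCube d)
    (h : dyadicCell d n x = dyadicCell d n y) :
    N (x - y) ≤ cubeDiameter N * (1 / 2) ^ n := by
  have h1 := seminorm_le_cubeDiameter N (v := (2 : ℝ) ^ n • (x - y)) fun i => by
    simpa using abs_sub_le_of_dyadicCell_eq hx hy h i
  rw [map_smul_eq_mul, Real.norm_of_nonneg (by positivity)] at h1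
  rw [one_div, inv_pow, ← div_eq_mul_inv, le_div_iff₀ (by positivity), mul_comm]
  exact h1

/-! ### The multiscale bound for the Wasserstein distance -/

theorem wassersteinDistance_le_of_coupling {d : ℕ} (N : Seminorm ℝ (Fin d → ℝ)) {p B : ℝ}
    (hp : 0 < p) (hB : 0 ≤ B) {μ ν : Measure (Fin d → ℝ)}
    {π : Measure ((Fin d → ℝ) × (Fin d → ℝ))} (hπ : π ∈ couplings μ ν)
    (h : ∫⁻ z, ENNReal.ofReal (N (z.1 - z.2) ^ p) ∂π ≤ ENNReal.ofReal B) :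
    wassersteinDistance N p μ ν ≠ ∞ ∧ (wassersteinDistance N p μ ν).toReal ^ p ≤ B := by
  have hp' : 0 ≤ 1 / p := by positivity
  have h1 : wassersteinDistance N p μ ν ≤ ENNReal.ofReal (B ^ (1 / p)) := by
    rw [← ENNReal.ofReal_rpow_of_nonneg hB hp']
    exact (iInf₂_le π hπ).trans (ENNReal.rpow_le_rpow h hp')
  refine ⟨(h1.trans_lt ENNReal.ofReal_lt_top).ne, ?_⟩
  have h2 : (wassersteinDistance N p μ ν).toReal ≤ B ^ (1 / p) :=
    ENNReal.toReal_le_of_le_ofReal (by positivity) h1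
  calc (wassersteinDistance N p μ ν).toReal ^ p ≤ (B ^ (1 / p)) ^ p :=
        Real.rpow_le_rpow ENNReal.toReal_nonneg h2 hp.le
    _ = B := by rw [one_div, Real.rpow_inv_rpow hB hp.ne']

/-- The bound obtained by matching mass down to the dyadic level `L`. -/
theorem wassersteinDistance_rpow_le {d : ℕ} (N : Seminorm ℝ (Fin d → ℝ)) {p : ℝ} (hp : 0 < p)
    (μ ν : Measure (Fin d → ℝ)) [IsProbabilityMeasure μ] [IsProbabilityMeasure ν]
    (hμ : μ (unitCube d) = 1) (hν : ν (unitCube d) = 1) (L : ℕ) :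
    wassersteinDistance N p μ ν ≠ ∞ ∧
      (wassersteinDistance N p μ ν).toReal ^ p ≤ cubeDiameter N ^ p *
        (((2 : ℝ) ^ (-p)) ^ L + (2 : ℝ) ^ p / 2 * uniformDiscrepancy μ ν *
          ∑ n ∈ Finset.range L, ((2 : ℝ) ^ ((d : ℝ) - p)) ^ (n + 1)) := by
  have hcube : MeasurableSet (unitCube d) := measurableSet_Icc
  have hμ' : ∀ᵐ x ∂μ, x ∈ unitCube d := (mem_ae_iff_prob_eq_one hcube).2 hμ
  have hν' : ∀ᵐ x ∂ν, x ∈ unitCube d := (mem_ae_iff_prob_eq_one hcube).2 hν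
  have hE := cubeDiameter_nonneg N
  have hD := uniformDiscrepancy_nonneg μ ν
  set E := cubeDiameter N
  set D := uniformDiscrepancy μ ν
  have hscale : ∀ n : ℕ, (E * (1 / 2) ^ n) ^ p = E ^ p * ((2 : ℝ) ^ (-p)) ^ n := fun n => by
    rw [Real.mul_rpow hE (by positivity), ← Real.rpow_natCast, ← Real.rpow_natCast,
      ← Real.rpow_mul (by positivity), mul_comm (n : ℝ) p, Real.rpow_mul (by positivity), one_div,
      Real.inv_rpow (by positivity), Real.rpow_neg (by positivity)]
  have hsub : Subsingleton (Fin d → Fin (2 ^ 0)) := by rw [pow_zero]; infer_instance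
  obtain ⟨π, h1, h2, h3⟩ := exists_multiscale_coupling (K := fun n => Fin d → Fin (2 ^ n)) μ ν
    (measurable_dyadicCell d) (dyadicCell_nested d) hμ' hν'
    (c := fun z => ENNReal.ofReal (N (z.1 - z.2) ^ p))
    (e := fun n => ENNReal.ofReal (E ^ p * ((2 : ℝ) ^ (-p)) ^ n))
    (fun n x hx y hy h => ENNReal.ofReal_le_ofReal (by
      rw [← hscale]
      exact Real.rpow_le_rpow (apply_nonneg N _) (seminorm_sub_le_of_dyadicCell_eq N hx hy h)
        hp.le)) L
  refine wassersteinDistance_le_of_coupling N hp (by positivity) ⟨h1, h2⟩ (h3.trans ?_)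
  have hterm : ∀ n : ℕ, ENNReal.ofReal (E ^ p * ((2 : ℝ) ^ (-p)) ^ n) *
      (1 - commonMass μ ν (dyadicCell d (n + 1))) ≤ ENNReal.ofReal
        (E ^ p * ((2 : ℝ) ^ p / 2 * D * ((2 : ℝ) ^ ((d : ℝ) - p)) ^ (n + 1))) := fun n => by
    refine (mul_le_mul_right (one_sub_commonMass_le μ ν (measurable_dyadicCell d (n + 1)) hD
      (abs_measureReal_dyadicCell_sub_le μ ν hμ' hν')) _).trans (le_of_eq ?_)
    rw [← ENNReal.ofReal_mul (by positivity)]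
    congr 1
    have hinv : (2 : ℝ) ^ p * (2 : ℝ) ^ (-p) = 1 := by
      rw [← Real.rpow_add two_pos, add_neg_cancel, Real.rpow_zero]
    rw [sub_eq_add_neg, Real.rpow_add two_pos, mul_pow, pow_succ ((2 : ℝ) ^ (-p)),
      Real.rpow_natCast]
    simp only [Fintype.card_pi, Fintype.card_fin, Finset.prod_const, Finset.card_univ]
    push_cast
    rw [← pow_mul, ← pow_mul, mul_comm d]
    linear_combination -(E ^ p * ((2 : ℝ) ^ (-p)) ^ n * 2 ^ ((n + 1) * d) * D / 2) * hinv
  refine (add_le_add_right (Finset.sum_le_sum fun n _ => hterm n) _).trans (le_of_eq ?_)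
  rw [← ENNReal.ofReal_sum_of_nonneg fun n _ => by positivity,
    ← ENNReal.ofReal_add (by positivity) (Finset.sum_nonneg fun n _ => by positivity),
    ← Finset.mul_sum, ← Finset.mul_sum, mul_add]

/-! ### Choice of the finest level -/

/-- The second factor of the multiscale bound at level `L`, as a function of the exponent `p`, the
dimension `d` and the discrepancy `D`. -/
noncomputable def multiscaleBound (p d D : ℝ) (L : ℕ) : ℝ :=
  ((2 : ℝ) ^ (-p)) ^ L +
    (2 : ℝ) ^ p / 2 * D * ∑ n ∈ Finset.range L, ((2 : ℝ) ^ (d - p)) ^ (n + 1)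

theorem tendsto_two_rpow_neg_pow {p : ℝ} (hp : 0 < p) :
    Filter.Tendsto (fun L : ℕ => ((2 : ℝ) ^ (-p)) ^ L) Filter.atTop (nhds 0) :=
  tendsto_pow_atTop_nhds_zero_of_lt_one (by positivity)
    (Real.rpow_lt_one_of_one_lt_of_neg one_lt_two (neg_lt_zero.2 hp))

theorem le_mul_of_forall_le_multiscaleBound_of_eq_zero {p d E V : ℝ} (hp : 0 < p)
    (h : ∀ L, V ≤ E * multiscaleBound p d 0 L) : V ≤ 0 := by
  have := (tendsto_two_rpow_neg_pow hp).const_mul E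
  rw [mul_zero] at this
  exact ge_of_tendsto' this fun L => by simpa [multiscaleBound] using h L

/-- The level at which the side `2⁻ᴸ` of the cells is matched to the discrepancy: the volume `2⁻ᵈᴸ`
is comparable to `D / 2`. -/
theorem exists_level {d D : ℝ} (hd : 0 < d) (hD : 0 < D) (hD1 : D ≤ 1) :
    ∃ L : ℕ, D / 2 ≤ ((2 : ℝ) ^ (-d)) ^ L ∧ ((2 : ℝ) ^ (-d)) ^ L ≤ 2 ^ d * (D / 2) := by
  obtain ⟨L, h1, h2⟩ := exists_nat_pow_near_of_lt_one (x := D / 2) (y := (2 : ℝ) ^ (-d))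
    (by positivity) (by linarith) (by positivity)
    (Real.rpow_lt_one_of_one_lt_of_neg one_lt_two (neg_lt_zero.2 hd))
  refine ⟨L, h2, ?_⟩
  have h3 := mul_le_mul_of_nonneg_left h1.le (by positivity : (0 : ℝ) ≤ 2 ^ d)
  have h4 : (2 : ℝ) ^ d * (2 : ℝ) ^ (-d) = 1 := by
    rw [← Real.rpow_add two_pos, add_neg_cancel, Real.rpow_zero]
  calc ((2 : ℝ) ^ (-d)) ^ L = 2 ^ d * ((2 : ℝ) ^ (-d)) ^ (L + 1) := by
        rw [pow_succ]; linear_combination -(((2 : ℝ) ^ (-d)) ^ L) * h4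
    _ ≤ _ := h3

/-- The quantities at the matched level: writing `P = 2⁻ᵖᴸ` and `R = 2^((d-p)L)`, one has
`P ≤ 2ᵖ (D/2)^(p/d)`, while `(D/2) R` lies above or below `(D/2)^(p/d)` according to the sign of
`p - d`. -/
theorem exists_level_estimates {p d D : ℝ} (hp : 0 < p) (hd : 0 < d) (hD : 0 < D) (hD1 : D ≤ 1) :
    ∃ L : ℕ, ((2 : ℝ) ^ (-p)) ^ L ≤ 2 ^ p * (D / 2) ^ (p / d) ∧
      (d ≤ p → (D / 2) ^ (p / d) ≤ D / 2 * ((2 : ℝ) ^ (d - p)) ^ L) ∧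
      (p ≤ d → D / 2 * ((2 : ℝ) ^ (d - p)) ^ L ≤ (D / 2) ^ (p / d)) ∧
      L * (d * Real.log 2) ≤ Real.log 2 + Real.log (1 / D) := by
  obtain ⟨L, h1, h2⟩ := exists_level hd hD hD1
  set w := ((2 : ℝ) ^ (-d)) ^ L with hw
  have hD2 : 0 < D / 2 := by positivity
  have hw0 : 0 < w := by positivity
  have hpow : ∀ s : ℝ, w ^ s = ((2 : ℝ) ^ (-d * s)) ^ L := fun s => by
    rw [hw, ← Real.rpow_natCast, ← Real.rpow_natCast, ← Real.rpow_mul two_pos.le,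
      ← Real.rpow_mul two_pos.le, ← Real.rpow_mul two_pos.le]
    congr 1; ring
  have hP : ((2 : ℝ) ^ (-p)) ^ L = w ^ (p / d) := by
    rw [hpow]; congr 2; field_simp
  have hR : ((2 : ℝ) ^ (d - p)) ^ L = w ^ (p / d - 1) := by
    rw [hpow]; congr 2; field_simp; ring
  have hsplit : (D / 2) ^ (p / d) = D / 2 * (D / 2) ^ (p / d - 1) := by
    rw [Real.rpow_sub_one hD2.ne']; field_simp
  refine ⟨L, ?_, fun hdp => ?_, fun hpd => ?_, ?_⟩
  · rw [hP]
    calc w ^ (p / d) ≤ (2 ^ d * (D / 2)) ^ (p / d) :=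
          Real.rpow_le_rpow hw0.le h2 (by positivity)
      _ = 2 ^ p * (D / 2) ^ (p / d) := by
        rw [Real.mul_rpow (by positivity) hD2.le, ← Real.rpow_mul two_pos.le,
          mul_div_cancel₀ _ hd.ne']
  · rw [hR, hsplit]
    exact mul_le_mul_of_nonneg_left (Real.rpow_le_rpow hD2.le h1
      (sub_nonneg.2 ((one_le_div hd).2 hdp))) hD2.le
  · rw [hR, hsplit]
    exact mul_le_mul_of_nonneg_left (Real.rpow_le_rpow_of_nonpos hD2 h1
      (sub_nonpos.2 ((div_le_one hd).2 hpd))) hD2.le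
  · have h3 := Real.log_le_log hD2 h1
    rw [hw, Real.log_pow, Real.log_rpow two_pos, Real.log_div hD.ne' two_ne_zero] at h3
    rw [one_div, Real.log_inv]
    linarith

theorem sum_geometric_succ {r : ℝ} (hr : r ≠ 1) (hr0 : r ≠ 0) (L : ℕ) :
    ∑ n ∈ Finset.range L, r ^ (n + 1) = (1 - r ^ L) / (r⁻¹ - 1) := by
  have h1 : r⁻¹ - 1 ≠ 0 := fun h => hr (inv_eq_one.1 (sub_eq_zero.1 h))
  have h2 : r - 1 ≠ 0 := sub_ne_zero.2 hr
  simp only [pow_succ]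
  rw [← Finset.sum_mul, geom_sum_eq hr, eq_div_iff h1]
  field_simp
  ring

theorem two_rpow_sub_inv (p d : ℝ) : ((2 : ℝ) ^ (d - p))⁻¹ = 2 ^ (p - d) := by
  rw [← Real.rpow_neg two_pos.le, neg_sub]

/-- Case `p > d`, with the infinite geometric sum. -/
theorem le_of_forall_le_multiscaleBound_of_lt {p d D E V : ℝ} (hd : 0 < d) (hpd : d < p)
    (hD : 0 ≤ D) (hE : 0 ≤ E) (h : ∀ L, V ≤ E * multiscaleBound p d D L) :
    V ≤ E * (2 ^ p + 1) / (2 * (2 ^ (p - d) - 1)) * D := by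
  have hr1 : (2 : ℝ) ^ (d - p) < 1 :=
    Real.rpow_lt_one_of_one_lt_of_neg one_lt_two (sub_neg.2 hpd)
  have hB : 0 < (2 : ℝ) ^ (p - d) - 1 :=
    sub_pos.2 (Real.one_lt_rpow one_lt_two (sub_pos.2 hpd))
  have hlim := ((tendsto_two_rpow_neg_pow (hd.trans hpd)).add_const
    ((2 : ℝ) ^ p / 2 * D * (1 / (2 ^ (p - d) - 1)))).const_mul E
  have hV := ge_of_tendsto' hlim fun L => (h L).trans (mul_le_mul_of_nonneg_left ?_ hE)
  · refine hV.trans ?_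
    have : E * (2 ^ p + 1) / (2 * (2 ^ (p - d) - 1)) * D =
        E * (0 + 2 ^ p / 2 * D * (1 / (2 ^ (p - d) - 1))) + E * D / (2 * (2 ^ (p - d) - 1)) := by
      field_simp; ring
    rw [this]
    exact le_add_of_nonneg_right (by positivity)
  · rw [multiscaleBound, sum_geometric_succ hr1.ne (by positivity), two_rpow_sub_inv]
    gcongr
    exact sub_le_self _ (by positivity)

/-- Case `p > d`, with the geometric sum cut at the matched level. -/
theorem le_of_forall_le_multiscaleBound_of_lt' {p d D E V : ℝ} (hd : 0 < d) (hpd : d < p)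
    (hD : 0 ≤ D) (hD1 : D ≤ 1) (hE : 0 ≤ E) (h : ∀ L, V ≤ E * multiscaleBound p d D L) :
    V ≤ E / (2 ^ (p - d) - 1) * ((2 ^ p + 1) / 2 * D -
      2 ^ (p * (1 - 1 / d)) * (1 + 2 ^ (-p) - 2 ^ (p - d)) * D ^ (p / d)) := by
  have hp : 0 < p := hd.trans hpd
  rcases hD.eq_or_lt with rfl | hD0
  · rw [Real.zero_rpow (by positivity)]
    simpa using le_mul_of_forall_le_multiscaleBound_of_eq_zero hp h
  have hr1 : (2 : ℝ) ^ (d - p) < 1 :=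
    Real.rpow_lt_one_of_one_lt_of_neg one_lt_two (sub_neg.2 hpd)
  have hB : 0 < (2 : ℝ) ^ (p - d) - 1 :=
    sub_pos.2 (Real.one_lt_rpow one_lt_two (sub_pos.2 hpd))
  obtain ⟨L, hP, hR₀, -, -⟩ := exists_level_estimates hp hd hD0 hD1
  have hR := hR₀ hpd.le
  refine (h L).trans ?_
  rw [div_mul_eq_mul_div, mul_div_assoc]
  refine mul_le_mul_of_nonneg_left ?_ hE
  rw [le_div_iff₀ hB, multiscaleBound, sum_geometric_succ hr1.ne (by positivity),
    two_rpow_sub_inv]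
  set t := (D / 2) ^ (p / d) with ht
  have ht0 : 0 < t := by positivity
  have htD : (2 : ℝ) ^ (p * (1 - 1 / d)) * D ^ (p / d) = 2 ^ p * t := by
    rw [ht, Real.div_rpow hD two_pos.le, mul_sub, mul_one, mul_one_div, Real.rpow_sub two_pos]
    ring
  have hinv : (2 : ℝ) ^ p * (2 : ℝ) ^ (-p) = 1 := by
    rw [← Real.rpow_add two_pos, add_neg_cancel, Real.rpow_zero]
  have hPB := mul_le_mul_of_nonneg_right hP hB.le
  have hR' := mul_le_mul_of_nonneg_left hR (Real.rpow_nonneg two_pos.le p)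
  have h2p : 1 ≤ (2 : ℝ) ^ p := Real.one_le_rpow one_le_two hp.le
  have hlast : t ≤ 2 ^ p * t := le_mul_of_one_le_left ht0.le h2p
  have hexp : (2 : ℝ) ^ (p * (1 - 1 / d)) * (1 + 2 ^ (-p) - 2 ^ (p - d)) * D ^ (p / d) =
      2 ^ p * t + t - 2 ^ p * t * 2 ^ (p - d) := by
    linear_combination (1 + 2 ^ (-p) - 2 ^ (p - d)) * htD + t * hinv
  rw [hexp, add_mul, mul_assoc _ _ ((2 : ℝ) ^ (p - d) - 1), div_mul_cancel₀ _ hB.ne']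
  nlinarith

/-- Case `p = d`: all scales up to the matched level contribute equally, whence the logarithm. -/
theorem le_of_forall_le_multiscaleBound_of_eq {d D E V : ℝ} (hd : 0 < d)
    (hD : 0 ≤ D) (hD1 : D ≤ 1) (hE : 0 ≤ E) (h : ∀ L, V ≤ E * multiscaleBound d d D L) :
    V ≤ E * (((d + 1) * 2 ^ (d - 1) / d + 1 / (2 * d)) * D +
      (2 ^ d + 1) / (2 * d * Real.log 2) * D * Real.log (1 / D)) := by
  rcases hD.eq_or_lt with rfl | hD0
  · simpa using le_mul_of_forall_le_multiscaleBound_of_eq_zero hd h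
  obtain ⟨L, hP, -, -, hL⟩ := exists_level_estimates hd hd hD0 hD1
  refine (h L).trans (mul_le_mul_of_nonneg_left ?_ hE)
  have hlog2 : 0 < Real.log 2 := Real.log_pos one_lt_two
  have hlogD : 0 ≤ Real.log (1 / D) := Real.log_nonneg (by rw [le_div_iff₀ hD0]; linarith)
  rw [div_self hd.ne', Real.rpow_one] at hP
  rw [← le_div_iff₀ (by positivity)] at hL
  have h2 : (2 : ℝ) ^ (d - 1) = 2 ^ d / 2 := by rw [Real.rpow_sub_one two_ne_zero]
  simp only [multiscaleBound, sub_self, Real.rpow_zero, one_pow, Finset.sum_const,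
    Finset.card_range, nsmul_eq_mul, mul_one, h2]
  have hmul := mul_le_mul_of_nonneg_left hL (by positivity : 0 ≤ (2 : ℝ) ^ d / 2 * D)
  have hslack : 0 ≤ 1 / (2 * d) * D + 1 / (2 * d * Real.log 2) * D * Real.log (1 / D) := by
    positivity
  refine (add_le_add hP hmul).trans (le_of_sub_nonneg (hslack.trans (le_of_eq ?_)))
  field_simp
  ring

/-- Case `p < d`: the geometric sum is dominated by its last term, at the matched level. -/
theorem le_of_forall_le_multiscaleBound_of_gt {p d D E V : ℝ} (hp : 0 < p) (hpd : p < d)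
    (hD : 0 ≤ D) (hD1 : D ≤ 1) (hE : 0 ≤ E) (h : ∀ L, V ≤ E * multiscaleBound p d D L) :
    V ≤ E * 2 ^ (-(p / d)) * ((2 ^ p + 1) / (1 - 2 ^ (p - d)) + 2 ^ p) * D ^ (p / d) := by
  have hd : 0 < d := hp.trans hpd
  rcases hD.eq_or_lt with rfl | hD0
  · rw [Real.zero_rpow (by positivity), mul_zero]
    exact le_mul_of_forall_le_multiscaleBound_of_eq_zero hp h
  have hr1 : 1 < (2 : ℝ) ^ (d - p) := Real.one_lt_rpow one_lt_two (sub_pos.2 hpd)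
  have hB : 0 < 1 - (2 : ℝ) ^ (p - d) :=
    sub_pos.2 (Real.rpow_lt_one_of_one_lt_of_neg one_lt_two (sub_neg.2 hpd))
  obtain ⟨L, hP, -, hR₀, -⟩ := exists_level_estimates hp hd hD0 hD1
  have hR := hR₀ hpd.le
  refine (h L).trans ?_
  rw [mul_assoc, mul_assoc]
  refine mul_le_mul_of_nonneg_left ?_ hE
  set t := (D / 2) ^ (p / d) with ht
  have ht0 : 0 < t := by positivity
  have htD : (2 : ℝ) ^ (-(p / d)) * D ^ (p / d) = t := by
    rw [ht, Real.div_rpow hD two_pos.le, Real.rpow_neg two_pos.le]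
    ring
  have htarget : (2 : ℝ) ^ (-(p / d)) * (((2 ^ p + 1) / (1 - 2 ^ (p - d)) + 2 ^ p) * D ^ (p / d)) =
      2 ^ p * t + (2 ^ p + 1) / (1 - 2 ^ (p - d)) * t := by
    rw [← htD]; ring
  rw [htarget, multiscaleBound]
  refine add_le_add hP ?_
  have hsum : ∑ n ∈ Finset.range L, ((2 : ℝ) ^ (d - p)) ^ (n + 1) =
      (((2 : ℝ) ^ (d - p)) ^ L - 1) / (1 - 2 ^ (p - d)) := by
    rw [sum_geometric_succ hr1.ne' (by positivity), two_rpow_sub_inv,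
      ← neg_div_neg_eq, neg_sub, neg_sub]
  rw [hsum, mul_div_assoc', div_mul_eq_mul_div ((2 : ℝ) ^ p + 1)]
  refine div_le_div_of_nonneg_right ?_ hB.le
  have h2p : 0 < (2 : ℝ) ^ p := by positivity
  nlinarith [mul_le_mul_of_nonneg_left hR h2p.le, mul_pos h2p hD0]

/-! ### The range of exponents of the refined bound -/

/-- With `x = 2ᵖ`, the condition reads `x² - 2ᵈ x - 2ᵈ < 0`. -/
theorem one_add_two_rpow_neg_sub_pos_iff (p d : ℝ) :
    0 < 1 + (2 : ℝ) ^ (-p) - (2 : ℝ) ^ (p - d) ↔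
      p < d + Real.log (1 + √(1 + (2 : ℝ) ^ (-(d - 2)))) / Real.log 2 - 1 := by
  have hlog2 : 0 < Real.log 2 := Real.log_pos one_lt_two
  set s := √(1 + (2 : ℝ) ^ (-(d - 2))) with hs
  have hs0 : 0 ≤ s := Real.sqrt_nonneg _
  set x := (2 : ℝ) ^ p with hx
  set y := (2 : ℝ) ^ d with hy
  have hx0 : 0 < x := by positivity
  have hy0 : 0 < y := by positivity
  have hs2 : s ^ 2 * y = y + 4 := by
    rw [hs, Real.sq_sqrt (by positivity), neg_sub, Real.rpow_sub two_pos, ← hy]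
    have : (2 : ℝ) ^ (2 : ℝ) = 4 := by norm_num
    rw [this]; field_simp
  have h1 : 0 < 1 + (2 : ℝ) ^ (-p) - (2 : ℝ) ^ (p - d) ↔ 0 < x * y + y - x ^ 2 := by
    rw [Real.rpow_neg two_pos.le, Real.rpow_sub two_pos, ← hx, ← hy]
    have : 1 + x⁻¹ - x / y = (x * y + y - x ^ 2) / (x * y) := by field_simp
    rw [this, div_pos_iff_of_pos_right (by positivity)]
  have h2 : p < d + Real.log (1 + s) / Real.log 2 - 1 ↔ 2 * x < y * (1 + s) := by
    rw [← Real.log_lt_log_iff (x := 2 * x) (by positivity) (by positivity),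
      Real.log_mul two_ne_zero hx0.ne', Real.log_mul hy0.ne' (by positivity), hx, hy,
      Real.log_rpow two_pos, Real.log_rpow two_pos]
    have : d + Real.log (1 + s) / Real.log 2 - 1 =
        (d * Real.log 2 + Real.log (1 + s) - Real.log 2) / Real.log 2 := by field_simp
    rw [this, lt_div_iff₀ hlog2]
    constructor <;> intro h <;> linarith
  -- Completing the square: `4 (x y + y - x²) = (y s)² - (2 x - y)²`.
  have h3 : 4 * (x * y + y - x ^ 2) = (y * s - (2 * x - y)) * (y * s + (2 * x - y)) := by
    linear_combination -y * hs2
  have h4 : 0 < y * s + (2 * x - y) := by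
    have : 1 ≤ s := by
      rw [hs, Real.one_le_sqrt]
      exact le_add_of_nonneg_right (by positivity)
    nlinarith
  rw [h1, h2]
  constructor
  · intro h
    have := pos_of_mul_pos_left (h3 ▸ mul_pos four_pos h) h4.le
    linarith
  · intro h
    have := mul_pos (by linarith : 0 < y * s - (2 * x - y)) h4
    linarith

/-! ### The bounds for the Wasserstein distance -/

theorem mainTheorem1 (d : ℕ) (hd : 1 ≤ d)
    (N : Seminorm ℝ (Fin d → ℝ)) (hN : ∀ x, N x = 0 → x = 0)
    (p : ℝ) (hp : 1 ≤ p)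
    (μ ν : Measure (Fin d → ℝ)) [IsProbabilityMeasure μ] [IsProbabilityMeasure ν]
    (hμ : μ (unitCube d) = 1) (hν : ν (unitCube d) = 1) :
    wassersteinDistance N p μ ν ≠ ∞ ∧
    ((d : ℝ) < p →
      (wassersteinDistance N p μ ν).toReal ^ p ≤
        cubeDiameter N ^ p * ((2 : ℝ) ^ p + 1) / (2 * ((2 : ℝ) ^ (p - d) - 1)) *
          uniformDiscrepancy μ ν ∧
      (0 < 1 + (2 : ℝ) ^ (-p) - (2 : ℝ) ^ (p - d) ↔
        p < d + Real.log (1 + √(1 + (2 : ℝ) ^ (-((d : ℝ) - 2)))) / Real.log 2 - 1) ∧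
      (0 < 1 + (2 : ℝ) ^ (-p) - (2 : ℝ) ^ (p - d) →
        (wassersteinDistance N p μ ν).toReal ^ p ≤
          cubeDiameter N ^ p / ((2 : ℝ) ^ (p - d) - 1) *
            (((2 : ℝ) ^ p + 1) / 2 * uniformDiscrepancy μ ν -
              (2 : ℝ) ^ (p * (1 - 1 / (d : ℝ))) *
                (1 + (2 : ℝ) ^ (-p) - (2 : ℝ) ^ (p - d)) *
                uniformDiscrepancy μ ν ^ (p / d)))) ∧
    (p = d →
      (wassersteinDistance N p μ ν).toReal ^ p ≤
        cubeDiameter N ^ d *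
          ((((d : ℝ) + 1) * (2 : ℝ) ^ ((d : ℝ) - 1) / d + 1 / (2 * d)) *
              uniformDiscrepancy μ ν +
            ((2 : ℝ) ^ d + 1) / (2 * d * Real.log 2) * uniformDiscrepancy μ ν *
              Real.log (1 / uniformDiscrepancy μ ν))) ∧
    (p < d →
      (wassersteinDistance N p μ ν).toReal ^ p ≤
        cubeDiameter N ^ p * (2 : ℝ) ^ (-(p / d)) *
          (((2 : ℝ) ^ p + 1) / (1 - (2 : ℝ) ^ (p - d)) + (2 : ℝ) ^ p) *
          uniformDiscrepancy μ ν ^ (p / d)) := by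
  have hp0 : 0 < p := zero_lt_one.trans_le hp
  have hd0 : (0 : ℝ) < d := by exact_mod_cast hd
  have hE : 0 ≤ cubeDiameter N ^ p := Real.rpow_nonneg (cubeDiameter_nonneg N) p
  have hD := uniformDiscrepancy_nonneg μ ν
  have hD1 := uniformDiscrepancy_le_one μ ν
  have h : ∀ L, (wassersteinDistance N p μ ν).toReal ^ p ≤
      cubeDiameter N ^ p * multiscaleBound p d (uniformDiscrepancy μ ν) L := fun L =>
    (wassersteinDistance_rpow_le N hp0 μ ν hμ hν L).2
  refine ⟨(wassersteinDistance_rpow_le N hp0 μ ν hμ hν 0).1, fun hdp =>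
    ⟨le_of_forall_le_multiscaleBound_of_lt hd0 hdp hD hE h,
      one_add_two_rpow_neg_sub_pos_iff p d,
      fun _ => le_of_forall_le_multiscaleBound_of_lt' hd0 hdp hD hD1 hE h⟩, ?_, fun hpd =>
    le_of_forall_le_multiscaleBound_of_gt hp0 hpd hD hD1 hE h⟩
  rintro rfl
  have := le_of_forall_le_multiscaleBound_of_eq hd0 hD hD1 hE h
  rwa [Real.rpow_natCast (cubeDiameter N), Real.rpow_natCast 2] at this
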